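/- Let $m,n\ge 2$ and let $(A,f,g)$ be a commutative Krasner $(m,n)$-hyperring with zero $0$ and scalar identity $1$: $(A,f)$ is a (commutative) canonical $m$-ary hypergroup with scalar identity $0$, $(A,g)$ is a commutative $n$-ary semigroup with $g(x,1^{(n-1)})=x$, $g$ is distributive over $f$, and $0$ is absorbing for $g$. Here $e^{(k)}$ stands for $e,\dots,e$ ($k$ times) and $x_i^j$ for $x_i,\dots,x_j$. A *hyperideal* of $A$ is a non-empty $Q\subseteq A$ such that $(Q,f)$ is an $m$-ary subhypergroup of $(A,f)$ and $g(x_1^{i-1},Q,x_{i+1}^n)\subseteq Q$ for all $x_1^n\in A$ and all $i$. A hyperideal $P\neq A$ is *prime* if, for all hyperideals $Q_1,\dots,Q_n$, $g(Q_1,\dots,Q_n)\subseteq P$ implies $Q_i\subseteq P$ for some $i$; $\mathrm{rad}(Q)$ is the intersection of all prime hyperideals containing $Q$ (and is $A$ if there are none); $(Q:s)=\{a\in A: g(a,s,1^{(n-2)})\in Q\}$. A non-empty $S\subseteq A$ is *$n$-ary multiplicative* if $g(s_1^n)\in S$ for all $s_1,\dots,s_n\in S$. For such an $S$, a hyperideal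 $Q$ with $Q\cap S=\varnothing$ is *weakly $n$-ary $S$-primary* if there is an $s\in S$ such that for all $a_1^n\in A$ with $0\ne g(a_1^n)\in Q$ and for every $i\in\{1,\dots,n\}$, $$g(s,a_i,1^{(n-2)})\in Q\quad\text{or}\quad g(a_1^{i-1},s,a_{i+1}^n)\in\mathrm{rad}(Q).$$ For an $n$-ary multiplicative $S$ with $1\in S$, $S^{-1}A$ is the set of fractions $a/s$ ($a\in A$, $s\in S$), where $a/s=b/t$ iff $0\in g\bigl(u,f(g(a,t,1^{(n-2)}),-g(b,s,1^{(n-2)}),0^{(m-2)}),1^{(n-2)}\bigr)$ for some $u\in S$. Writing $xy=g(x,y,1^{(n-2)})$, its operations are $$F\Bigl(\tfrac{x_1}{t_1},\dots,\tfrac{x_m}{t_m}\Bigr)=\Bigl\{\tfrac{z}{t_1\cdots t_m}: z\in f(x_1t_2\cdots t_m,\ \dots,\ t_1\cdots t_{m-1}x_m)\Bigr\},\qquad G\Bigl(\tfrac{x_1}{t_1},\dots,\tfrac{x_n}{t_n}\Bigr)=\frac{g(x_1^n)}{g(t_1^n)},$$ with zero $0/1$ and identity $1/1$; hyperideals, radicals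 and weakly primary hyperideals of $S^{-1}A$ are defined through $F$, $G$, $0/1$, $1/1$ as above. For $B\subseteq A$ put $S^{-1}B=\{b/t: b\in B,\ t\in S\}$. **Theorem.** Let $S_1\subseteq S_2\subseteq A$ be $n$-ary multiplicative sets with $1\in S_1$, and let $Q$ be a hyperideal of $A$ with $S_2\cap Q=\varnothing$. If $Q$ is weakly $n$-ary $S_1$-primary, then (i) $S_2^{-1}Q$ is a weakly $n$-ary $S_2^{-1}S_1$-primary hyperideal of $S_2^{-1}A$; (ii) there is an $s\in S_1$ with $S_2^{-1}Q\cap A=(Q:s)\cup 0_{S_2}$, where $S_2^{-1}Q\cap A=\{a\in A: a/1\in S_2^{-1}Q\}$ and $0_{S_2}=\{x\in A: g(x,t,1^{(n-2)})=0\text{ for some }t\in S_2\}$. -/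

import Mathlib

universe u

/-- The operations of a hyperring of type `(m, n)` on `A`: an `m`-ary hyperoperation `f`, an `n`-ary
operation `g`, a zero and an identity.  The axioms are in `HyperOps.IsCommKrasner`. -/
structure HyperOps (m n : ℕ) (A : Type u) where
  f : (Fin m → A) → Set A
  g : (Fin n → A) → A
  zero : A
  one : A

namespace HyperOps

variable {m n : ℕ} {A : Type u}

/-- The `k`-tuple `(l₁, …, l_r, e, …, e)`, where `l` has `r ≤ k` entries. -/
def tup (k : ℕ) (e : A) (l : List A) : Fin k → A := fun i => l.getD i e

/-- With zero-based indices, the `k`-tuple `(x₀, …, x_{i-1}, y, x_{i+k}, …, x_{2k-2})`. -/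
def splice (k : ℕ) (x : ℕ → A) (i : ℕ) (y : A) : Fin k → A :=
  fun j => if (j : ℕ) < i then x j else if (j : ℕ) = i then y else x (j + k - 1)

/-- The binary product `g(a, b, 1, …, 1)`. -/
def mul (H : HyperOps m n A) (a b : A) : A := H.g (tup n H.one [a, b])

/-- The product of finitely many elements, each step being a binary product. -/
def listProd (H : HyperOps m n A) (l : List A) : A := l.foldr H.mul H.one

/-- `y` is an additive inverse of `x`: `0 ∈ f(x, y, 0, …, 0)`. -/
def IsNeg (H : HyperOps m n A) (x y : A) : Prop := H.zero ∈ H.f (tup m H.zero [x, y])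

/-- Commutative Krasner `(m, n)`-hyperrings with scalar identity. -/
structure IsCommKrasner (H : HyperOps m n A) : Prop where
  two_le_m : 2 ≤ m
  two_le_n : 2 ≤ n
  -- `(A, f)` is a commutative `m`-ary hypergroup
  f_nonempty : ∀ a, (H.f a).Nonempty
  f_assoc : ∀ (x : ℕ → A) (i j : Fin m),
    (⋃ y ∈ H.f (fun k => x (i + k)), H.f (splice m x i y)) =
      ⋃ y ∈ H.f (fun k => x (j + k)), H.f (splice m x j y)
  f_solve : ∀ (a : Fin m → A) (i : Fin m) (b : A), ∃ x, b ∈ H.f (Function.update a i x)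
  f_comm : ∀ (σ : Equiv.Perm (Fin m)) (a : Fin m → A), H.f (a ∘ σ) = H.f a
  -- it is canonical: unique scalar identity, unique inverses, reversibility
  f_zero : ∀ x, H.f (tup m H.zero [x]) = {x}
  zero_unique : ∀ e, (∀ x, H.f (tup m e [x]) = {x}) → e = H.zero
  neg_unique : ∀ x, ∃! y, H.IsNeg x y
  -- as `f` is commutative, the position of `x` among the arguments is immaterial
  f_rev : ∀ (x : A) (a b : Fin m → A), x ∈ H.f a → (∀ j, H.IsNeg (a j) (b j)) →
    ∀ i, a i ∈ H.f (Function.update b i x)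
  -- `(A, g)` is a commutative `n`-ary semigroup with scalar identity
  g_assoc : ∀ (x : ℕ → A) (i j : Fin n),
    H.g (splice n x i (H.g (fun k => x (i + k)))) = H.g (splice n x j (H.g (fun k => x (j + k))))
  g_comm : ∀ (σ : Equiv.Perm (Fin n)) (a : Fin n → A), H.g (a ∘ σ) = H.g a
  g_one : ∀ (x : A) (i : Fin n), H.g (Function.update (fun _ => H.one) i x) = x
  -- distributivity, and `0` is absorbing
  distrib : ∀ (a : Fin n → A) (i : Fin n) (x : Fin m → A),
    (fun y => H.g (Function.update a i y)) '' H.f x = H.f fun k => H.g (Function.update a i (x k))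
  g_zero : ∀ (a : Fin n → A) (i : Fin n), a i = H.zero → H.g a = H.zero

/-- Hyperideals: non-empty `m`-ary subhypergroups (associativity is inherited) absorbing `g`. -/
structure IsHyperideal (H : HyperOps m n A) (Q : Set A) : Prop where
  nonempty : Q.Nonempty
  f_subset : ∀ a : Fin m → A, (∀ i, a i ∈ Q) → H.f a ⊆ Q
  f_solve : ∀ a : Fin m → A, (∀ i, a i ∈ Q) → ∀ (i : Fin m), ∀ b ∈ Q,
    ∃ x ∈ Q, b ∈ H.f (Function.update a i x)
  g_mem : ∀ (a : Fin n → A) (i : Fin n), a i ∈ Q → H.g a ∈ Q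

/-- Prime hyperideals: `g(Q₁, …, Qₙ) ⊆ P` implies `Qᵢ ⊆ P` for some `i`. -/
structure IsPrimeHyperideal (H : HyperOps m n A) (P : Set A) : Prop where
  hyperideal : H.IsHyperideal P
  ne_univ : P ≠ Set.univ
  prime : ∀ Q : Fin n → Set A, (∀ i, H.IsHyperideal (Q i)) →
    (∀ a : Fin n → A, (∀ i, a i ∈ Q i) → H.g a ∈ P) → ∃ i, Q i ⊆ P

/-- The radical: the intersection of the prime hyperideals containing `Q` (all of `A` if there are
none). -/
def rad (H : HyperOps m n A) (Q : Set A) : Set A := ⋂₀ {P | H.IsPrimeHyperideal P ∧ Q ⊆ P}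

/-- The residual `(Q : x)`. -/
def colon (H : HyperOps m n A) (Q : Set A) (x : A) : Set A :=
  {a | H.g (tup n H.one [a, x]) ∈ Q}

/-- `n`-ary multiplicative subsets. -/
structure IsMultiplicative (H : HyperOps m n A) (S : Set A) : Prop where
  nonempty : S.Nonempty
  g_mem : ∀ a : Fin n → A, (∀ i, a i ∈ S) → H.g a ∈ S

/-- Weakly `n`-ary `S`-primary hyperideals. -/
structure IsWeaklySPrimary (H : HyperOps m n A) (S Q : Set A) : Prop where
  hyperideal : H.IsHyperideal Q
  multiplicative : H.IsMultiplicative S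
  disjoint : Q ∩ S = ∅
  primary : ∃ s ∈ S, ∀ a : Fin n → A, H.g a ≠ H.zero → H.g a ∈ Q →
    ∀ i, H.g (tup n H.one [s, a i]) ∈ Q ∨ H.g (Function.update a i s) ∈ H.rad Q

/-- The set `0_S` of elements annihilated by some element of `S`. -/
def zeroAt (H : HyperOps m n A) (S : Set A) : Set A :=
  {x | ∃ t ∈ S, H.g (tup n H.one [x, t]) = H.zero}

/-- `(a, s) ∼ (b, t)` iff `0 ∈ g(u, f(g(a,t,1,…,1), -g(b,s,1,…,1), 0,…,0), 1,…,1)` for some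
`u ∈ S`. -/
def FracRel (H : HyperOps m n A) (S : Set A) (p q : A × S) : Prop :=
  ∃ u ∈ S, ∃ y, H.IsNeg (H.g (tup n H.one [q.1, p.2])) y ∧
    ∃ w ∈ H.f (tup m H.zero [H.g (tup n H.one [p.1, q.2]), y]),
      H.zero = H.g (tup n H.one [u, w, H.one])

namespace IsCommKrasner

variable {H : HyperOps m n A}

theorem mul_comm' (hH : H.IsCommKrasner) (a b : A) : H.mul a b = H.mul b a := by
  have hn := hH.two_le_n
  unfold mul
  rw [← hH.g_comm (Equiv.swap ⟨0, by omega⟩ ⟨1, by omega⟩)]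
  congr 1
  funext i
  rcases i with ⟨_ | _ | i, hi⟩
  · simp [tup]
  · simp [tup]
  · rw [Function.comp_apply, Equiv.swap_apply_of_ne_of_ne] <;> simp [tup]

theorem one_mul' (hH : H.IsCommKrasner) (a : A) : H.mul H.one a = a := by
  have hn := hH.two_le_n
  rw [hH.mul_comm']
  conv_rhs => rw [← hH.g_one a ⟨0, by omega⟩]
  unfold mul
  congr 1
  funext i
  rcases i with ⟨_ | _ | i, hi⟩ <;> simp [tup, Function.update]

theorem mul_assoc' (hH : H.IsCommKrasner) (a b c : A) :
    H.mul (H.mul a b) c = H.mul a (H.mul b c) := by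
  have hn := hH.two_le_n
  have key := hH.g_assoc
    (fun j => if j = 0 then a else if j = 1 then b else if j = n then c else H.one)
    ⟨0, by omega⟩ ⟨1, by omega⟩
  have h1 : H.g (fun k : Fin n => if ((0 : ℕ) + k : ℕ) = 0 then a else if (0 + k : ℕ) = 1 then b
      else if (0 + k : ℕ) = n then c else H.one) = H.mul a b := by
    unfold mul
    congr 1
    funext i
    rcases i with ⟨_ | _ | i, hi⟩
    · simp [tup]
    · simp [tup]
    · have : i + 1 + 1 ≠ n := by omega
      simp [tup, this]
  have h2 : H.g (fun k : Fin n => if ((1 : ℕ) + k : ℕ) = 0 then a else if (1 + k : ℕ) = 1 then b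
      else if (1 + k : ℕ) = n then c else H.one) = H.mul b c := by
    unfold mul
    rw [← hH.g_comm (Equiv.swap ⟨1, by omega⟩ ⟨n - 1, by omega⟩) (tup n H.one [b, c])]
    congr 1
    funext i
    by_cases h0 : (i : ℕ) = 0
    · rw [Function.comp_apply, Equiv.swap_apply_of_ne_of_ne] <;> simp [tup, h0, Fin.ext_iff]
      omega
    · by_cases h3 : (i : ℕ) = n - 1
      · rcases i with ⟨i, hi⟩
        simp only at h3
        subst h3
        have h4 : 1 + (n - 1) = n := by omega
        simp only [h4]
        rw [if_neg (by omega), if_neg (by omega)]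
        simp [tup]
      · by_cases h5 : (i : ℕ) = 1
        · rcases i with ⟨i, hi⟩
          simp only at h5
          subst h5
          have h6 : 2 ≠ n := by simp at h3; omega
          have h7 : ∃ k, n - 1 = k + 2 := ⟨n - 3, by omega⟩
          obtain ⟨k, hk⟩ := h7
          simp [tup, h6, hk]
        · obtain ⟨k, hk⟩ : ∃ k, (i : ℕ) = k + 2 := ⟨i - 2, by omega⟩
          rw [Function.comp_apply, Equiv.swap_apply_of_ne_of_ne]
          · have : 1 + (k + 2) ≠ n := by omega
            simp [tup, hk, this]
          · simp [Fin.ext_iff, h5]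
          · simp [Fin.ext_iff, h3]
  simp only [h1, h2] at key
  have h3 : splice n (fun j => if j = 0 then a else if j = 1 then b else if j = n then c
      else H.one) 0 (H.mul a b) = tup n H.one [H.mul a b, c] := by
    funext i
    rcases i with ⟨_ | _ | i, hi⟩
    · simp [tup, splice]
    · have h4 : n ≠ 1 := by omega
      have h5 : n ≠ 0 := by omega
      simp [tup, splice, h4, h5]
    · simp [tup, splice]
      omega
  have h4 : splice n (fun j => if j = 0 then a else if j = 1 then b else if j = n then c
      else H.one) 1 (H.mul b c) = tup n H.one [a, H.mul b c] := by
    funext i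
    rcases i with ⟨_ | _ | i, hi⟩
    · simp [tup, splice]
    · simp [tup, splice]
    · simp [tup, splice]
      omega
  rw [h3, h4] at key
  exact key

/-- The commutative monoid underlying the multiplication. -/
@[reducible] def commMonoid (hH : H.IsCommKrasner) : CommMonoid A where
  mul := H.mul
  mul_assoc := hH.mul_assoc'
  one := H.one
  one_mul := hH.one_mul'
  mul_one a := (hH.mul_comm' a H.one).trans (hH.one_mul' a)
  mul_comm := hH.mul_comm'

theorem g_concat (hH : H.IsCommKrasner) (l : List A) (b : A) (hl : l.length < n) :
    H.g (tup n H.one (l ++ [b])) = H.mul (H.g (tup n H.one l)) b := by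
  have hn := hH.two_le_n
  rcases Nat.eq_zero_or_pos l.length with h0 | hpos
  · have : l = [] := List.eq_nil_of_length_eq_zero h0
    subst this
    have e1 : H.g (tup n H.one []) = H.one := by
      conv_rhs => rw [← hH.g_one H.one ⟨0, by omega⟩]
      congr 1
      funext i
      simp [tup]
    have e2 : H.g (tup n H.one ([] ++ [b])) = b := by
      conv_rhs => rw [← hH.g_one b ⟨0, by omega⟩]
      congr 1
      funext i
      rcases i with ⟨_ | i, hi⟩ <;> simp [tup, Function.update]
    rw [e1, e2, hH.one_mul']
  · set x : ℕ → A := fun j => if j < l.length then l.getD j H.one else if j = n then b else H.one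
      with hx
    have key := hH.g_assoc x ⟨0, by omega⟩ ⟨l.length, hl⟩
    have h1 : (fun k : Fin n => x (((⟨0, by omega⟩ : Fin n) : ℕ) + k)) = tup n H.one l := by
      funext i
      have hi := i.2
      simp only [hx, tup, Nat.zero_add]
      split_ifs with h h'
      · rfl
      · omega
      · rw [List.getD_eq_default _ _ (by omega)]
    have h2 : H.g (fun k : Fin n => x (((⟨l.length, hl⟩ : Fin n) : ℕ) + k)) = b := by
      conv_rhs => rw [← hH.g_one b ⟨n - l.length, by omega⟩]
      congr 1
      funext i
      simp only [hx, Function.update_apply, Fin.ext_iff]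
      rw [if_neg (by omega)]
      by_cases h : (i : ℕ) = n - l.length
      · rw [if_pos (by omega), if_pos h]
      · rw [if_neg (by omega), if_neg h]
    rw [h1, h2] at key
    have h3 : ∀ y, splice n x 0 y = tup n H.one [y, b] := by
      intro y
      funext i
      rcases i with ⟨_ | _ | i, hi⟩
      · simp [tup, splice]
      · have : ¬ n < l.length := by omega
        simp [tup, splice, hx, this]
      · have h5 : ¬ i + 1 + 1 + n - 1 < l.length := by omega
        have h6 : i + 1 + 1 + n - 1 ≠ n := by omega
        simp only [splice, hx, h5, h6]
        simp [tup]
    have h4 : splice n x l.length b = tup n H.one (l ++ [b]) := by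
      funext i
      have hi := i.2
      simp only [splice, tup, hx]
      split_ifs with h5 h6 h7 h8
      · rw [List.getD_append _ _ _ _ h5]
      · simp [h6]
      · omega
      · omega
      · rw [List.getD_eq_default _ _ (by simp; omega)]
    simp only [h3, h4] at key
    exact key.symm

theorem listProd_eq (hH : H.IsCommKrasner) (l : List A) :
    H.listProd l = (letI := hH.commMonoid; l.prod) := by
  let _ := hH.commMonoid
  rfl

theorem g_tup_eq (hH : H.IsCommKrasner) (l : List A) (hl : l.length ≤ n) :
    H.g (tup n H.one l) = (letI := hH.commMonoid; l.prod) := by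
  let _ := hH.commMonoid
  induction l using List.reverseRecOn with
  | nil =>
    have hn := hH.two_le_n
    refine Eq.trans ?_ (hH.g_one H.one ⟨0, by omega⟩)
    congr 1
    funext i
    simp [tup]
  | append_singleton l b ih =>
    have h : l.length < n := by simpa using hl
    rw [hH.g_concat l b h, ih h.le, List.prod_append, List.prod_singleton]
    rfl

theorem g_eq_prod (hH : H.IsCommKrasner) (a : Fin n → A) :
    H.g a = (letI := hH.commMonoid; ∏ i, a i) := by
  let _ := hH.commMonoid
  have h1 : a = tup n H.one (List.ofFn a) := by
    funext i
    simp [tup, List.getD]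
  conv_lhs => rw [h1]
  rw [hH.g_tup_eq _ (by simp)]
  exact List.prod_ofFn

/-- The binary distributive law for a two-term hypersum. -/
theorem mul_image (hH : H.IsCommKrasner) (u x y : A) :
    H.mul u '' H.f (tup m H.zero [x, y]) = H.f (tup m H.zero [H.mul u x, H.mul u y]) := by
  have hn := hH.two_le_n
  have h1 : ∀ w, Function.update (tup n H.one [u]) ⟨1, by omega⟩ w = tup n H.one [u, w] := by
    intro w
    funext i
    rcases i with ⟨_ | _ | i, hi⟩ <;> simp [tup, Function.update]
  have h2 := hH.distrib (tup n H.one [u]) ⟨1, by omega⟩ (tup m H.zero [x, y])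
  simp only [h1] at h2
  refine h2.trans ?_
  congr 1
  funext i
  rcases i with ⟨_ | _ | i, hi⟩
  · rfl
  · rfl
  · exact hH.g_zero _ ⟨1, by omega⟩ (by simp [tup])

theorem mul_zero' (hH : H.IsCommKrasner) (u : A) : H.mul u H.zero = H.zero := by
  have hn := hH.two_le_n
  exact hH.g_zero _ ⟨1, by omega⟩ (by simp [tup])

theorem isNeg_comm (hH : H.IsCommKrasner) {x y : A} (h : H.IsNeg x y) : H.IsNeg y x := by
  have hm := hH.two_le_m
  unfold IsNeg at *
  rw [← hH.f_comm (Equiv.swap ⟨0, by omega⟩ ⟨1, by omega⟩)] at h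
  convert h using 2
  funext i
  rcases i with ⟨_ | _ | i, hi⟩
  · simp [tup]
  · simp [tup]
  · rw [Function.comp_apply, Equiv.swap_apply_of_ne_of_ne] <;> simp [tup]

theorem isNeg_mul (hH : H.IsCommKrasner) (u : A) {x y : A} (h : H.IsNeg x y) :
    H.IsNeg (H.mul u x) (H.mul u y) := by
  unfold IsNeg at *
  rw [← hH.mul_image]
  exact ⟨H.zero, h, hH.mul_zero' u⟩

theorem mul_rel_iff (hH : H.IsCommKrasner) (u x y z : A) (h : H.IsNeg y z) :
    (∃ w ∈ H.f (tup m H.zero [x, z]), H.zero = H.mul u w) ↔ H.mul u x = H.mul u y := by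
  have h1 := hH.isNeg_mul u h
  have h2 : (∃ w ∈ H.f (tup m H.zero [x, z]), H.zero = H.mul u w) ↔
      H.IsNeg (H.mul u x) (H.mul u z) := by
    unfold IsNeg
    rw [← hH.mul_image]
    simp [eq_comm]
  rw [h2]
  constructor
  · intro h3
    exact (hH.neg_unique (H.mul u z)).unique (hH.isNeg_comm h3) (hH.isNeg_comm h1)
  · intro h3
    rw [h3]
    exact h1

/-- The defining relation of fractions says `u a t = u b s` for some `u ∈ S`. -/
theorem fracRel_iff (hH : H.IsCommKrasner) {S : Set A} (p q : A × S) :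
    H.FracRel S p q ↔ ∃ u ∈ S, H.mul u (H.mul p.1 q.2) = H.mul u (H.mul q.1 p.2) := by
  have h0 : ∀ u w : A, tup n H.one [u, w, H.one] = tup n H.one [u, w] := by
    intro u w
    funext i
    rcases i with ⟨_ | _ | _ | i, hi⟩ <;> simp [tup]
  constructor
  · rintro ⟨u, hu, y, hy, w, hw, h⟩
    rw [h0] at h
    exact ⟨u, hu, (hH.mul_rel_iff u _ _ y hy).1 ⟨w, hw, h⟩⟩
  · rintro ⟨u, hu, h⟩
    obtain ⟨y, hy, -⟩ := hH.neg_unique (H.mul q.1 p.2)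
    obtain ⟨w, hw, h'⟩ := (hH.mul_rel_iff u _ _ y hy).2 h
    exact ⟨u, hu, y, hy, w, hw, by rw [h0]; exact h'⟩

theorem mul_mem' (_ : H.IsCommKrasner) {S : Set A} (hS : H.IsMultiplicative S)
    (h1 : H.one ∈ S) {a b : A} (ha : a ∈ S) (hb : b ∈ S) : H.mul a b ∈ S := by
  refine hS.g_mem _ fun i => ?_
  rcases i with ⟨_ | _ | i, hi⟩ <;> simpa [tup]

theorem listProd_mem (hH : H.IsCommKrasner) {S : Set A} (hS : H.IsMultiplicative S)
    (h1 : H.one ∈ S) (l : List A) (hl : ∀ a ∈ l, a ∈ S) : H.listProd l ∈ S := by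
  induction l with
  | nil => exact h1
  | cons a l ih =>
    exact hH.mul_mem' hS h1 (hl a (by simp)) (ih fun b hb => hl b (by simp [hb]))

/-- The relation defining fractions, for a multiplicative set containing `1`. -/
def fracSetoid (hH : H.IsCommKrasner) {S : Set A} (hS : H.IsMultiplicative S)
    (h1 : H.one ∈ S) : Setoid (A × S) where
  r := H.FracRel S
  iseqv := by
    let _ := hH.commMonoid
    refine ⟨fun p => ?_, fun {p q} h => ?_, fun {p q r} h h' => ?_⟩
    · exact (hH.fracRel_iff p p).2 ⟨H.one, h1, rfl⟩
    · obtain ⟨u, hu, h⟩ := (hH.fracRel_iff p q).1 h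
      exact (hH.fracRel_iff q p).2 ⟨u, hu, h.symm⟩
    · obtain ⟨u, hu, h⟩ := (hH.fracRel_iff p q).1 h
      obtain ⟨v, hv, h'⟩ := (hH.fracRel_iff q r).1 h'
      refine (hH.fracRel_iff p r).2
        ⟨H.mul (H.mul u v) q.2, hH.mul_mem' hS h1 (hH.mul_mem' hS h1 hu hv) q.2.2, ?_⟩
      change u * (p.1 * (q.2 : A)) = u * (q.1 * (p.2 : A)) at h
      change v * (q.1 * (r.2 : A)) = v * (r.1 * (q.2 : A)) at h'
      change u * v * q.2 * (p.1 * (r.2 : A)) = u * v * q.2 * (r.1 * (p.2 : A))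
      calc u * v * q.2 * (p.1 * (r.2 : A)) = v * r.2 * (u * (p.1 * (q.2 : A))) := by ac_rfl
        _ = v * r.2 * (u * (q.1 * (p.2 : A))) := by rw [h]
        _ = u * p.2 * (v * (q.1 * (r.2 : A))) := by ac_rfl
        _ = u * p.2 * (v * (r.1 * (q.2 : A))) := by rw [h']
        _ = u * v * q.2 * (r.1 * (p.2 : A)) := by ac_rfl

end IsCommKrasner

section Fractions

variable {H : HyperOps m n A} {S : Set A}

/-- The set `S⁻¹A` of fractions. -/
def Frac (hH : H.IsCommKrasner) (hS : H.IsMultiplicative S) (h1 : H.one ∈ S) : Type u :=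
  Quotient (hH.fracSetoid hS h1)

/-- The fraction `a / s`. -/
def Frac.mk (hH : H.IsCommKrasner) (hS : H.IsMultiplicative S) (h1 : H.one ∈ S) (a : A) (s : S) :
    Frac hH hS h1 :=
  Quotient.mk (hH.fracSetoid hS h1) (a, s)

theorem g_frac_congr (hH : H.IsCommKrasner) (hS : H.IsMultiplicative S) (h1 : H.one ∈ S)
    (p q : Fin n → A × S) (h : ∀ i, H.FracRel S (p i) (q i)) :
    Frac.mk hH hS h1 (H.g fun i => (p i).1) ⟨H.g fun i => (p i).2, hS.g_mem _ fun i => (p i).2.2⟩ =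
    Frac.mk hH hS h1 (H.g fun i => (q i).1)
      ⟨H.g fun i => (q i).2, hS.g_mem _ fun i => (q i).2.2⟩ := by
  let _ := hH.commMonoid
  refine Quotient.sound ((hH.fracRel_iff _ _).2 ?_)
  have h2 := fun i => (hH.fracRel_iff _ _).1 (h i)
  choose u hu h3 using h2
  refine ⟨H.g u, hS.g_mem u hu, ?_⟩
  simp only [hH.g_eq_prod]
  change (∏ i, u i) * ((∏ i, (p i).1) * ∏ i, ((q i).2 : A)) =
    (∏ i, u i) * ((∏ i, (q i).1) * ∏ i, ((p i).2 : A))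
  simp only [← Finset.prod_mul_distrib]
  exact Finset.prod_congr rfl fun i _ => h3 i

/-- The operations of the hyperring of fractions `S⁻¹A`:
`F(x₁/t₁, …, xₘ/tₘ)` is the set of all `z / (t₁ ⋯ tₘ)` with
`z ∈ f(x₁ t₂ ⋯ tₘ, …, t₁ ⋯ tₘ₋₁ xₘ)`, and `G(x₁/t₁, …, xₙ/tₙ) = g(x₁, …, xₙ) / g(t₁, …, tₙ)`. -/
def fracOps (hH : H.IsCommKrasner) (hS : H.IsMultiplicative S) (h1 : H.one ∈ S) :
    HyperOps m n (Frac hH hS h1) where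
  f ξ := {ζ | ∃ (x : Fin m → A) (t : Fin m → S), (∀ i, ξ i = Frac.mk hH hS h1 (x i) (t i)) ∧
    ∃ z ∈ H.f (fun i => H.listProd (List.ofFn (Function.update (fun j => (t j : A)) i (x i)))),
      ζ = Frac.mk hH hS h1 z ⟨H.listProd (List.ofFn fun j => (t j : A)),
        hH.listProd_mem hS h1 _ (by simp [List.mem_ofFn])⟩}
  g ξ := Quotient.finLiftOn (S := fun _ => hH.fracSetoid hS h1) ξ
    (fun p => Frac.mk hH hS h1 (H.g fun i => (p i).1)
      ⟨H.g fun i => (p i).2, hS.g_mem _ fun i => (p i).2.2⟩)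
    (g_frac_congr hH hS h1)
  zero := Frac.mk hH hS h1 H.zero ⟨H.one, h1⟩
  one := Frac.mk hH hS h1 H.one ⟨H.one, h1⟩

/-- The set `S⁻¹B` of all fractions `b / t` with `b ∈ B` and `t ∈ S`. -/
def fracSet (hH : H.IsCommKrasner) (hS : H.IsMultiplicative S) (h1 : H.one ∈ S) (B : Set A) :
    Set (Frac hH hS h1) :=
  {ζ | ∃ b ∈ B, ∃ t : S, ζ = Frac.mk hH hS h1 b t}

end Fractions

end HyperOps

/-! The binary product makes `A` a commutative monoid whose `n`-fold product is `g`, so a factor can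
be moved into any coordinate (`g_update_mul`). Membership in `S⁻¹Q` becomes a condition in `A`:
`a/s` lies there iff `u a ∈ Q` for some `u ∈ S` (`mk_mem_fracSet_iff`).

For (i), a nonzero product of fractions in `S⁻¹Q` gives `u` with `0 ≠ u g(a) ∈ Q`. Put `u` into a
coordinate other than `i` and apply the hypothesis on `Q`. In the radical alternative `u` comes out
again and is cancelled: it becomes invertible in `S⁻¹A`, and primes over `S⁻¹Q` contract to primes
over `Q` (`mk_mem_rad_fracSet`).

For (ii), let `a u ∈ Q` with `u ∈ S₂`. If `a u ≠ 0`, then `s a ∈ Q` or `s u ∈ rad Q`. The latter is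
impossible, since by Zorn's lemma `rad Q` misses `S₂` (`disjoint_rad`). -/

namespace HyperOps

variable {m n : ℕ} {A : Type u} {H : HyperOps m n A}

/-! ### Hyperideals and residuals -/

namespace IsHyperideal

theorem mul_mem {Q : Set A} (hQ : H.IsHyperideal Q) (hH : H.IsCommKrasner) (u : A) {a : A}
    (ha : a ∈ Q) : H.mul u a ∈ Q :=
  hQ.g_mem _ ⟨1, hH.two_le_n⟩ (by simpa [tup] using ha)

theorem mul_mem_left {Q : Set A} (hQ : H.IsHyperideal Q) (hH : H.IsCommKrasner) {a : A} (u : A)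
    (ha : a ∈ Q) : H.mul a u ∈ Q := by
  rw [hH.mul_comm']
  exact hQ.mul_mem hH u ha

theorem zero_mem {Q : Set A} (hQ : H.IsHyperideal Q) (hH : H.IsCommKrasner) : H.zero ∈ Q := by
  obtain ⟨a, ha⟩ := hQ.nonempty
  rw [← hH.mul_zero' a]
  exact hQ.mul_mem_left hH _ ha

end IsHyperideal

namespace IsCommKrasner

/-- Distributivity of the binary product over an `m`-ary hypersum. -/
theorem mul_image_f (hH : H.IsCommKrasner) (u : A) (x : Fin m → A) :
    H.mul u '' H.f x = H.f fun k => H.mul u (x k) := by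
  have hn := hH.two_le_n
  have h1 : ∀ w, Function.update (tup n H.one [u]) ⟨1, by omega⟩ w = tup n H.one [u, w] := by
    intro w
    funext i
    rcases i with ⟨_ | _ | i, hi⟩ <;> simp [tup, Function.update]
  have h2 := hH.distrib (tup n H.one [u]) ⟨1, by omega⟩ x
  simp only [h1] at h2
  exact h2

theorem mul_mem_f (hH : H.IsCommKrasner) (u : A) {x : Fin m → A} {z : A} (hz : z ∈ H.f x) :
    H.mul u z ∈ H.f fun k => H.mul u (x k) := by
  rw [← hH.mul_image_f]
  exact ⟨z, hz, rfl⟩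

/-- In a Krasner hyperring solvability in a hyperideal follows from the closure properties. -/
theorem isHyperideal_of_closed (hH : H.IsCommKrasner) {Q : Set A} (hne : Q.Nonempty)
    (hf : ∀ a : Fin m → A, (∀ i, a i ∈ Q) → H.f a ⊆ Q)
    (hg : ∀ (a : Fin n → A) (i : Fin n), a i ∈ Q → H.g a ∈ Q) : H.IsHyperideal Q := by
  refine ⟨hne, hf, fun a ha i b hb => ?_, hg⟩
  obtain ⟨x, hx⟩ := hH.f_solve a i b
  -- With `e = -1`, the inverse of `y` is `y e`, so absorption puts inverses of elements of `Q` back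
  -- in `Q`.
  obtain ⟨e, he, -⟩ := hH.neg_unique H.one
  have hneg : ∀ y, H.IsNeg y (H.mul y e) := fun y => by
    have h := hH.isNeg_mul y he
    rwa [hH.mul_comm' y H.one, hH.one_mul'] at h
  refine ⟨x, ?_, hx⟩
  -- Reversibility writes `x` as a member of the hypersum of `b` and the negatives of the other `a
  -- j`, all in `Q`.
  have h1 := hH.f_rev b _ (fun j => H.mul (Function.update a i x j) e) hx (fun j => hneg _) i
  rw [Function.update_self] at h1
  refine hf _ (fun j => ?_) h1
  rcases eq_or_ne j i with rfl | hj
  · simpa using hb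
  · rw [Function.update_of_ne hj, Function.update_of_ne hj]
    exact hg _ ⟨0, by have := hH.two_le_n; omega⟩ (by simpa [tup] using ha j)

theorem g_update_mul (hH : H.IsCommKrasner) (a : Fin n → A) (j : Fin n) (u : A) :
    H.g (Function.update a j (H.mul u (a j))) = H.mul u (H.g a) := by
  let _ := hH.commMonoid
  rw [hH.g_eq_prod, hH.g_eq_prod, Finset.prod_update_of_mem (Finset.mem_univ j),
    ← Finset.mul_prod_erase _ a (Finset.mem_univ j), Finset.sdiff_singleton_eq_erase]
  exact hH.mul_assoc' _ _ _

theorem isHyperideal_colon (hH : H.IsCommKrasner) {Q : Set A} (hQ : H.IsHyperideal Q) (s : A) :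
    H.IsHyperideal (H.colon Q s) := by
  have hmem : ∀ a, a ∈ H.colon Q s ↔ H.mul s a ∈ Q := fun a => by
    rw [hH.mul_comm']
    rfl
  refine hH.isHyperideal_of_closed ⟨H.zero, ?_⟩ (fun a ha z hz => ?_) fun a i hi => ?_
  · rw [hmem, hH.mul_zero']
    exact hQ.zero_mem hH
  · rw [hmem]
    exact hQ.f_subset _ (fun i => (hmem _).1 (ha i)) (hH.mul_mem_f s hz)
  · rw [hmem, ← hH.g_update_mul a i s]
    exact hQ.g_mem _ i (by simpa using (hmem _).1 hi)

theorem subset_colon (hH : H.IsCommKrasner) {Q : Set A} (hQ : H.IsHyperideal Q) (s : A) :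
    Q ⊆ H.colon Q s := fun _ ha => hQ.mul_mem_left hH s ha

/-! ### Prime hyperideals and the radical -/

theorem isHyperideal_sUnion (hH : H.IsCommKrasner) {c : Set (Set A)}
    (hc : ∀ Q ∈ c, H.IsHyperideal Q) (hchain : IsChain (· ⊆ ·) c) (hne : c.Nonempty) :
    H.IsHyperideal (⋃₀ c) := by
  obtain ⟨Q₀, hQ₀⟩ := hne
  refine hH.isHyperideal_of_closed ?_ (fun a ha => ?_) fun a i hi => ?_
  · exact ⟨H.zero, Q₀, hQ₀, (hc _ hQ₀).zero_mem hH⟩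
  -- An `m`-tuple has finite range, so one member of the chain contains all its entries.
  · have h := DirectedOn.exists_mem_subset_of_finite_of_subset_sUnion ⟨Q₀, hQ₀⟩
      hchain.directedOn (Set.finite_range a) (by rintro _ ⟨i, rfl⟩; exact ha i)
    obtain ⟨Q, hQ, h⟩ := h
    exact fun z hz => ⟨Q, hQ, (hc Q hQ).f_subset a (fun i => h ⟨i, rfl⟩) hz⟩
  · obtain ⟨Q, hQ, h⟩ := hi
    exact ⟨Q, hQ, (hc Q hQ).g_mem a i h⟩

/-- The complement of `P` is a submonoid, so choosing one element of each `Q i` outside `P` gives a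
product outside `P`. -/
theorem isPrimeHyperideal_of_mul_mem (hH : H.IsCommKrasner) {P : Set A} (hP : H.IsHyperideal P)
    (h1 : H.one ∉ P) (h : ∀ a b, H.mul a b ∈ P → a ∈ P ∨ b ∈ P) : H.IsPrimeHyperideal P := by
  refine ⟨hP, fun h' => h1 (h' ▸ Set.mem_univ _), fun Q _ hg => ?_⟩
  by_contra! hcon
  have h2 := fun i => Set.not_subset.1 (hcon i)
  choose q hq hqP using h2
  let _ := hH.commMonoid
  have h3 : ∏ i, q i ∈ Pᶜ := Finset.prod_induction q (· ∈ Pᶜ)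
    (fun a b ha hb hab => (h a b hab).elim ha hb) h1 fun i _ => hqP i
  exact h3 (hH.g_eq_prod q ▸ hg q hq)

/-- A hyperideal disjoint from a multiplicative set is contained in a prime hyperideal disjoint
from it. -/
theorem exists_isPrimeHyperideal_disjoint (hH : H.IsCommKrasner) {S Q : Set A}
    (hS : H.IsMultiplicative S) (h1 : H.one ∈ S) (hQ : H.IsHyperideal Q) (hd : Disjoint Q S) :
    ∃ P, H.IsPrimeHyperideal P ∧ Q ⊆ P ∧ Disjoint P S := by
  obtain ⟨P, hQP, hP⟩ := zorn_subset_nonempty {P | H.IsHyperideal P ∧ Disjoint P S}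
    (fun c hc hchain hne => ⟨⋃₀ c, ⟨hH.isHyperideal_sUnion (fun P hP => (hc hP).1) hchain hne,
      Set.disjoint_sUnion_left.2 fun P hP => (hc hP).2⟩, fun _ => Set.subset_sUnion_of_mem⟩)
    Q ⟨hQ, hd⟩
  refine ⟨P, hH.isPrimeHyperideal_of_mul_mem hP.prop.1
    (fun h => Set.disjoint_left.1 hP.prop.2 h h1) (fun a b hab => ?_), hQP, hP.prop.2⟩
  -- By maximality, a residual of `P` that avoids `S` is `P` itself.
  have hmax : ∀ c, Disjoint (H.colon P c) S → ∀ x, H.mul x c ∈ P → x ∈ P := fun c hc x hx =>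
    hP.le_of_ge ⟨hH.isHyperideal_colon hP.prop.1 c, hc⟩ (hH.subset_colon hP.prop.1 c) hx
  by_cases hb : Disjoint (H.colon P b) S
  · exact Or.inl (hmax b hb a hab)
  -- Now `s b ∈ P` with `s ∈ S`. The residual by `s` avoids `S`, because `t s` lies in `S` for `t ∈
  -- S`; hence it is `P`, and it contains `b`.
  · obtain ⟨s, hs, hsS⟩ := Set.not_disjoint_iff.1 hb
    refine Or.inr (hmax s (Set.disjoint_left.2 fun t ht htS => ?_) b ?_)
    · exact Set.disjoint_left.1 hP.prop.2 ht (hH.mul_mem' hS h1 htS hsS)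
    · rw [hH.mul_comm']
      exact hs

theorem disjoint_rad (hH : H.IsCommKrasner) {S Q : Set A} (hS : H.IsMultiplicative S)
    (h1 : H.one ∈ S) (hQ : H.IsHyperideal Q) (hd : Disjoint Q S) : Disjoint (H.rad Q) S := by
  obtain ⟨P, hP, hQP, hPS⟩ := hH.exists_isPrimeHyperideal_disjoint hS h1 hQ hd
  exact hPS.mono_left (Set.sInter_subset_of_mem ⟨hP, hQP⟩)

end IsCommKrasner

/-! ### Fractions and extended hyperideals -/

section Fractions

variable {S : Set A} (hH : H.IsCommKrasner) (hS : H.IsMultiplicative S) (h1 : H.one ∈ S)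

theorem Frac.exists_mk (ξ : Frac hH hS h1) : ∃ a s, ξ = Frac.mk hH hS h1 a s := by
  obtain ⟨p, rfl⟩ := Quotient.exists_rep ξ
  exact ⟨p.1, p.2, rfl⟩

theorem Frac.mk_eq_mk_iff {a b : A} {s t : S} :
    Frac.mk hH hS h1 a s = Frac.mk hH hS h1 b t ↔
      ∃ u ∈ S, H.mul u (H.mul a t) = H.mul u (H.mul b s) :=
  (Quotient.eq (r := hH.fracSetoid hS h1)).trans (hH.fracRel_iff (a, s) (b, t))

theorem Frac.mk_eq_mk {a b : A} {s t : S} (h : H.mul a t = H.mul b s) :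
    Frac.mk hH hS h1 a s = Frac.mk hH hS h1 b t :=
  (Frac.mk_eq_mk_iff hH hS h1).2 ⟨H.one, h1, by rw [h]⟩

theorem fracOps_g_mk (a : Fin n → A) (t : Fin n → S) :
    (fracOps hH hS h1).g (fun i => Frac.mk hH hS h1 (a i) (t i)) =
      Frac.mk hH hS h1 (H.g a) ⟨H.g fun i => t i, hS.g_mem _ fun i => (t i).2⟩ :=
  congrFun (congrFun (Quotient.finLiftOn_mk (S := fun _ => hH.fracSetoid hS h1)
    fun i => (a i, t i)) _) _

theorem fracOps_mul_mk (a b : A) (s t : S) :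
    (fracOps hH hS h1).mul (Frac.mk hH hS h1 a s) (Frac.mk hH hS h1 b t) =
      Frac.mk hH hS h1 (H.mul a b) ⟨H.mul s t, hH.mul_mem' hS h1 s.2 t.2⟩ := by
  have h2 : tup n (fracOps hH hS h1).one [Frac.mk hH hS h1 a s, Frac.mk hH hS h1 b t] =
      fun i => Frac.mk hH hS h1 (tup n H.one [a, b] i) (tup n ⟨H.one, h1⟩ [s, t] i) := by
    funext i
    rcases i with ⟨_ | _ | i, hi⟩ <;> rfl
  have h3 : (fun i => ((tup n ⟨H.one, h1⟩ [s, t] : Fin n → S) i : A)) = tup n H.one [(s : A), t] := by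
    funext i
    rcases i with ⟨_ | _ | i, hi⟩ <;> rfl
  refine (congrArg _ h2).trans ((fracOps_g_mk hH hS h1 _ _).trans ?_)
  exact congrArg _ (Subtype.ext (congrArg H.g h3))

/-- The criterion does not depend on the representative: if `u a t = u b s` with `b ∈ Q`, then `u t`
carries `a` into `Q`. -/
theorem mk_mem_fracSet_iff {Q : Set A} (hQ : H.IsHyperideal Q) {a : A} {s : S} :
    Frac.mk hH hS h1 a s ∈ fracSet hH hS h1 Q ↔ ∃ u ∈ S, H.mul u a ∈ Q := by
  let _ := hH.commMonoid
  constructor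
  · rintro ⟨b, hb, t, h⟩
    obtain ⟨u, hu, h⟩ := (Frac.mk_eq_mk_iff hH hS h1).1 h
    refine ⟨H.mul u t, hH.mul_mem' hS h1 hu t.2, ?_⟩
    have h2 : H.mul (H.mul u t) a = H.mul u (H.mul a t) := by
      rw [hH.mul_assoc', hH.mul_comm' a]
    rw [h2, h]
    exact hQ.mul_mem hH u (hQ.mul_mem_left hH s hb)
  · rintro ⟨u, hu, h⟩
    refine ⟨_, h, ⟨H.mul u s, hH.mul_mem' hS h1 hu s.2⟩, Frac.mk_eq_mk hH hS h1 ?_⟩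
    change a * (u * (s : A)) = u * a * (s : A)
    ac_rfl

theorem listProd_update (t : Fin m → A) (i : Fin m) (x : A) :
    H.listProd (List.ofFn (Function.update t i x)) =
      (letI := hH.commMonoid; (∏ j ∈ Finset.univ.erase i, t j) * x) := by
  let _ := hH.commMonoid
  rw [hH.listProd_eq, List.prod_ofFn, Finset.prod_update_of_mem (Finset.mem_univ i),
    Finset.sdiff_singleton_eq_erase, mul_comm]

theorem IsCommKrasner.finsetProd_mem (hH : H.IsCommKrasner) (hS : H.IsMultiplicative S)
    (h1 : H.one ∈ S) {ι : Type*} (s : Finset ι) (t : ι → A) (ht : ∀ i, t i ∈ S) :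
    (letI := hH.commMonoid; ∏ i ∈ s, t i) ∈ S := by
  let _ := hH.commMonoid
  exact Finset.prod_induction t (· ∈ S) (fun a b => hH.mul_mem' hS h1) h1 fun i _ => ht i

/-- Hypersums of fractions with a common denominator. -/
theorem mk_mem_fracOps_f {y : Fin m → A} {z : A} (D : S) (hz : z ∈ H.f y) :
    Frac.mk hH hS h1 z D ∈ (fracOps hH hS h1).f fun i => Frac.mk hH hS h1 (y i) D := by
  let _ := hH.commMonoid
  have hm := hH.two_le_m
  -- Over equal denominators `D` the defining numerators are `D ^ (m - 1) * y i` and the denominator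
  -- is `D ^ m`, so `z` is scaled by `D ^ (m - 1)`.
  refine ⟨y, fun _ => D, fun _ => rfl, H.mul ((D : A) ^ (m - 1)) z, ?_, ?_⟩
  · convert hH.mul_mem_f ((D : A) ^ (m - 1)) hz using 2
    funext i
    rw [listProd_update hH, Finset.prod_const, Finset.card_erase_of_mem (Finset.mem_univ i)]
    simp
    rfl
  · refine Frac.mk_eq_mk hH hS h1 ?_
    change z * H.listProd _ = (D : A) ^ (m - 1) * z * D
    rw [hH.listProd_eq, List.prod_ofFn, Finset.prod_const, Finset.card_univ, Fintype.card_fin,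
      mul_right_comm, ← pow_succ, Nat.sub_add_cancel (by omega), mul_comm]

/-- The Krasner axioms are not established for `S⁻¹A`, so solvability is proved directly: pass to a
common denominator and solve for the numerators inside `Q`. -/
theorem isHyperideal_fracSet {Q : Set A} (hQ : H.IsHyperideal Q) :
    (fracOps hH hS h1).IsHyperideal (fracSet hH hS h1 Q) := by
  let _ := hH.commMonoid
  refine ⟨?_, ?_, ?_, ?_⟩
  · obtain ⟨a, ha⟩ := hQ.nonempty
    exact ⟨_, a, ha, ⟨H.one, h1⟩, rfl⟩
  · rintro ξ hξ _ ⟨x, t, hx, z, hz, rfl⟩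
    have h2 : ∀ i, ∃ u ∈ S, H.mul u (x i) ∈ Q := fun i =>
      (mk_mem_fracSet_iff hH hS h1 hQ).1 (hx i ▸ hξ i)
    choose u hu hux using h2
    refine (mk_mem_fracSet_iff hH hS h1 hQ).2
      ⟨∏ i, u i, hH.finsetProd_mem hS h1 Finset.univ u hu, ?_⟩
    refine hQ.f_subset _ (fun i => ?_) (hH.mul_mem_f (∏ i, u i) hz)
    rw [listProd_update hH, ← Finset.mul_prod_erase _ u (Finset.mem_univ i)]
    have h3 := hQ.mul_mem hH ((∏ j ∈ Finset.univ.erase i, u j) *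
      ∏ j ∈ Finset.univ.erase i, (t j : A)) (hux i)
    convert h3 using 1
    change u i * _ * (_ * x i) = _ * _ * (u i * x i)
    ac_rfl
  · intro ξ hξ i ζ hζ
    choose b hb t ht using hξ
    obtain ⟨c, hc, r, rfl⟩ := hζ
    -- The common denominator is `r T`; `e j` is the product of the other `t`'s, which turns `b j /
    -- t j` into `r (e j) (b j) / (r T)`.
    let T : A := ∏ j, (t j : A)
    have hT : T ∈ S := hH.finsetProd_mem hS h1 Finset.univ (fun j => (t j : A)) fun j => (t j).2
    let e : Fin m → A := fun i => ∏ j ∈ Finset.univ.erase i, (t j : A)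
    have he : ∀ i, (t i : A) * e i = T := fun i =>
      Finset.mul_prod_erase _ (fun j => (t j : A)) (Finset.mem_univ i)
    let D : S := ⟨H.mul r T, hH.mul_mem' hS h1 r.2 hT⟩
    have h2 : ∀ j, ξ j = Frac.mk hH hS h1 (H.mul (H.mul r (e j)) (b j)) D := fun j => by
      rw [ht j]
      refine Frac.mk_eq_mk hH hS h1 ?_
      change b j * ((r : A) * T) = (r : A) * e j * b j * t j
      rw [← he j]
      ac_rfl
    have h3 : Frac.mk hH hS h1 c r = Frac.mk hH hS h1 (H.mul T c) D := by
      refine Frac.mk_eq_mk hH hS h1 ?_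
      change c * ((r : A) * T) = T * c * r
      ac_rfl
    obtain ⟨x, hxQ, hx⟩ := hQ.f_solve (fun j => H.mul (H.mul r (e j)) (b j))
      (fun j => hQ.mul_mem hH _ (hb j)) i _ (hQ.mul_mem hH T hc)
    refine ⟨Frac.mk hH hS h1 x D, ⟨x, hxQ, D, rfl⟩, ?_⟩
    rw [h3]
    convert mk_mem_fracOps_f hH hS h1 D hx using 2
    funext j
    rcases eq_or_ne j i with rfl | hj
    · simp
    · simp [hj, h2]
  · intro ξ i hi
    have h2 := fun j => Frac.exists_mk hH hS h1 (ξ j)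
    choose a t h2 using h2
    obtain rfl := funext h2
    obtain ⟨u, hu, h⟩ := (mk_mem_fracSet_iff hH hS h1 hQ).1 hi
    rw [fracOps_g_mk, mk_mem_fracSet_iff hH hS h1 hQ]
    refine ⟨u, hu, ?_⟩
    rw [← hH.g_update_mul a i u]
    exact hQ.g_mem _ i (by simpa using h)

/-! ### Contraction to `A` and radicals -/

theorem mk_mem_of_mk_mul_mem {P : Set (Frac hH hS h1)} (hP : (fracOps hH hS h1).IsHyperideal P)
    {u e : A} (hu : u ∈ S) {s : S} (h : Frac.mk hH hS h1 (H.mul u e) s ∈ P) (t : S) :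
    Frac.mk hH hS h1 e t ∈ P := by
  let _ := hH.commMonoid
  -- Elements of `S` are invertible: `e/t = (u e / s) · (s / (u t))`.
  have h2 : Frac.mk hH hS h1 e t = (fracOps hH hS h1).mul (Frac.mk hH hS h1 (H.mul u e) s)
      (Frac.mk hH hS h1 s ⟨H.mul u t, hH.mul_mem' hS h1 hu t.2⟩) := by
    rw [fracOps_mul_mk]
    refine Frac.mk_eq_mk hH hS h1 ?_
    change e * ((s : A) * (u * (t : A))) = u * e * s * t
    ac_rfl
  rw [h2]
  exact hP.g_mem _ ⟨0, by have := hH.two_le_n; omega⟩ (by simpa [tup] using h)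

theorem isHyperideal_contraction {P : Set (Frac hH hS h1)}
    (hP : (fracOps hH hS h1).IsHyperideal P) :
    H.IsHyperideal {a | Frac.mk hH hS h1 a ⟨H.one, h1⟩ ∈ P} := by
  refine hH.isHyperideal_of_closed ?_ (fun a ha z hz => ?_) fun a i hi => ?_
  · obtain ⟨ξ, hξ⟩ := hP.nonempty
    obtain ⟨a, s, rfl⟩ := Frac.exists_mk hH hS h1 ξ
    -- Cancelling the trivial factor `1` only serves to change the denominator.
    refine ⟨a, mk_mem_of_mk_mul_mem hH hS h1 hP h1 (s := s) ?_ _⟩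
    rwa [hH.one_mul']
  · exact hP.f_subset _ ha (mk_mem_fracOps_f hH hS h1 _ hz)
  · have h2 := hP.g_mem (fun j => Frac.mk hH hS h1 (a j) ⟨H.one, h1⟩) i hi
    rw [fracOps_g_mk] at h2
    refine mk_mem_of_mk_mul_mem hH hS h1 hP h1
      (s := ⟨H.g fun _ => H.one, hS.g_mem _ fun _ => h1⟩) ?_ _
    rwa [hH.one_mul']

/-- Primality of `P` is applied to the extensions `S⁻¹(Q i)`: a product of their elements has its
numerator in the contraction, hence lies in `P`. -/
theorem isPrimeHyperideal_contraction {P : Set (Frac hH hS h1)}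
    (hP : (fracOps hH hS h1).IsPrimeHyperideal P) :
    H.IsPrimeHyperideal {a | Frac.mk hH hS h1 a ⟨H.one, h1⟩ ∈ P} := by
  refine ⟨isHyperideal_contraction hH hS h1 hP.hyperideal, fun h => hP.ne_univ ?_,
    fun Q hQ hg => ?_⟩
  · refine Set.eq_univ_of_forall fun ξ => ?_
    obtain ⟨a, s, rfl⟩ := Frac.exists_mk hH hS h1 ξ
    have ha : a ∈ {a | Frac.mk hH hS h1 a ⟨H.one, h1⟩ ∈ P} := h ▸ Set.mem_univ a
    refine mk_mem_of_mk_mul_mem hH hS h1 hP.hyperideal h1 (s := ⟨H.one, h1⟩) ?_ s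
    rwa [hH.one_mul']
  · obtain ⟨i, hi⟩ := hP.prime (fun i => fracSet hH hS h1 (Q i))
      (fun i => isHyperideal_fracSet hH hS h1 (hQ i)) (fun ξ hξ => by
        choose b hb t ht using hξ
        obtain rfl := funext ht
        rw [fracOps_g_mk]
        refine mk_mem_of_mk_mul_mem hH hS h1 hP.hyperideal h1 (s := ⟨H.one, h1⟩) ?_ _
        rw [hH.one_mul']
        exact hg b hb)
    exact ⟨i, fun q hq => hi ⟨q, hq, _, rfl⟩⟩

/-- Each prime over `S⁻¹Q` contracts to a prime over `Q`, which contains `u e`; the unit `u` then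
cancels. -/
theorem mk_mem_rad_fracSet {Q : Set A} {u e : A} (hu : u ∈ S) (h : H.mul u e ∈ H.rad Q) (t : S) :
    Frac.mk hH hS h1 e t ∈ (fracOps hH hS h1).rad (fracSet hH hS h1 Q) := by
  rintro P ⟨hP, hQP⟩
  refine mk_mem_of_mk_mul_mem hH hS h1 hP.hyperideal hu (s := ⟨H.one, h1⟩) ?_ t
  exact h _ ⟨isPrimeHyperideal_contraction hH hS h1 hP, fun q hq => hQP ⟨q, hq, _, rfl⟩⟩

/-! ### The two assertions of the theorem -/

theorem isMultiplicative_fracSet {T : Set A} (hT : H.IsMultiplicative T) :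
    (fracOps hH hS h1).IsMultiplicative (fracSet hH hS h1 T) := by
  refine ⟨?_, fun ξ hξ => ?_⟩
  · obtain ⟨a, ha⟩ := hT.nonempty
    exact ⟨_, a, ha, ⟨H.one, h1⟩, rfl⟩
  · choose b hb t ht using hξ
    obtain rfl := funext ht
    rw [fracOps_g_mk]
    exact ⟨_, hT.g_mem b hb, _, rfl⟩

theorem isWeaklySPrimary_fracSet {S₁ Q : Set A} (hsub : S₁ ⊆ S) (hd : Disjoint Q S)
    (hQ : H.IsWeaklySPrimary S₁ Q) :
    (fracOps hH hS h1).IsWeaklySPrimary (fracSet hH hS h1 S₁) (fracSet hH hS h1 Q) := by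
  refine ⟨isHyperideal_fracSet hH hS h1 hQ.hyperideal,
    isMultiplicative_fracSet hH hS h1 hQ.multiplicative, ?_, ?_⟩
  · rw [← Set.disjoint_iff_inter_eq_empty, Set.disjoint_right]
    rintro _ ⟨s, hs, t, rfl⟩ h
    obtain ⟨u, hu, h⟩ := (mk_mem_fracSet_iff hH hS h1 hQ.hyperideal).1 h
    exact Set.disjoint_left.1 hd h (hH.mul_mem' hS h1 hu (hsub hs))
  · obtain ⟨s, hs, hprim⟩ := hQ.primary
    refine ⟨Frac.mk hH hS h1 s ⟨H.one, h1⟩, ⟨s, hs, _, rfl⟩, fun ξ hξ0 hξ i => ?_⟩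
    have h2 := fun j => Frac.exists_mk hH hS h1 (ξ j)
    choose a t h2 using h2
    obtain rfl := funext h2
    rw [fracOps_g_mk] at hξ0 hξ
    obtain ⟨u, hu, h⟩ := (mk_mem_fracSet_iff hH hS h1 hQ.hyperideal).1 hξ
    -- If `u` killed `g a`, it would witness that the fraction is zero.
    have h0 : H.mul u (H.g a) ≠ H.zero := fun h0 => hξ0 <|
      (Frac.mk_eq_mk_iff hH hS h1).2 ⟨u, hu, by
        rw [← hH.mul_assoc', h0, hH.mul_comm' H.zero, hH.mul_zero', hH.mul_comm' H.zero,
          hH.mul_zero', hH.mul_zero']⟩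
    have : Nontrivial (Fin n) := Fin.nontrivial_iff_two_le.2 hH.two_le_n
    -- Placing `u` at `j ≠ i` leaves `a i` untouched for the first alternative and survives the
    -- replacement of `a i` by `s` in the second.
    obtain ⟨j, hj⟩ := exists_ne i
    rw [← hH.g_update_mul a j u] at h h0
    refine (hprim _ h0 h i).imp (fun h3 => ?_) fun h3 => ?_
    · rw [Function.update_of_ne hj.symm] at h3
      change (fracOps hH hS h1).mul _ _ ∈ _
      rw [fracOps_mul_mk]
      exact ⟨_, h3, _, rfl⟩
    · have h4 : Function.update (fun j => Frac.mk hH hS h1 (a j) (t j)) i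
          (Frac.mk hH hS h1 s ⟨H.one, h1⟩) = fun k => Frac.mk hH hS h1
            (Function.update a i s k) (Function.update t i ⟨H.one, h1⟩ k) := by
        funext k
        rcases eq_or_ne k i with rfl | hk
        · simp
        · simp [hk]
      rw [h4, fracOps_g_mk]
      refine mk_mem_rad_fracSet hH hS h1 hu ?_ _
      rw [Function.update_comm hj] at h3
      have h5 := hH.g_update_mul (Function.update a i s) j u
      rw [Function.update_of_ne hj] at h5
      rwa [← h5]

theorem exists_contraction_fracSet_eq {S₁ Q : Set A} (hsub : S₁ ⊆ S) (hd : Disjoint Q S)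
    (hQ : H.IsWeaklySPrimary S₁ Q) :
    ∃ s ∈ S₁, {a : A | Frac.mk hH hS h1 a ⟨H.one, h1⟩ ∈ fracSet hH hS h1 Q} =
      H.colon Q s ∪ H.zeroAt S := by
  have hn := hH.two_le_n
  obtain ⟨s, hs, hprim⟩ := hQ.primary
  refine ⟨s, hs, Set.ext fun a => ?_⟩
  refine (mk_mem_fracSet_iff hH hS h1 hQ.hyperideal).trans ?_
  change _ ↔ H.mul a s ∈ Q ∨ ∃ t ∈ S, H.mul a t = H.zero
  constructor
  · rintro ⟨u, hu, h⟩
    rw [hH.mul_comm'] at h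
    by_cases h0 : H.mul a u = H.zero
    · exact Or.inr ⟨u, hu, h0⟩
    -- The hypothesis is applied to `(a, u, 1, …, 1)` at the coordinate of `a`.
    · refine Or.inl ((hprim _ h0 h ⟨0, by omega⟩).elim (fun h2 => ?_) fun h2 => ?_)
      · rw [hH.mul_comm']
        exact h2
      · have h3 : Function.update (tup n H.one [a, u]) ⟨0, by omega⟩ s = tup n H.one [s, u] := by
          funext i
          rcases i with ⟨_ | i, hi⟩ <;> simp [tup, Function.update]
        rw [h3] at h2
        -- Here `s u` would lie in both `S` and `rad Q`.
        exact absurd (hH.mul_mem' hS h1 (hsub hs) hu)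
          (Set.disjoint_left.1 (hH.disjoint_rad hS h1 hQ.hyperideal hd) h2)
  · rintro (h | ⟨t, ht, h⟩)
    · exact ⟨s, hsub hs, by rwa [hH.mul_comm']⟩
    · refine ⟨t, ht, ?_⟩
      rw [hH.mul_comm', h]
      exact hQ.hyperideal.zero_mem hH

end Fractions

end HyperOps

theorem mainTheorem9 {m n : ℕ} {A : Type*} (H : HyperOps m n A) (hH : H.IsCommKrasner)
    (S₁ S₂ Q : Set A) (hS₁ : H.IsMultiplicative S₁) (hS₂ : H.IsMultiplicative S₂)
    (hS : S₁ ⊆ S₂) (h1 : H.one ∈ S₁) (hQ : H.IsHyperideal Q) (hd : S₂ ∩ Q = ∅)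
    (hprim : H.IsWeaklySPrimary S₁ Q) :
    (HyperOps.fracOps hH hS₂ (hS h1)).IsWeaklySPrimary
      (HyperOps.fracSet hH hS₂ (hS h1) S₁) (HyperOps.fracSet hH hS₂ (hS h1) Q) ∧
    ∃ s ∈ S₁, {a : A | HyperOps.Frac.mk hH hS₂ (hS h1) a ⟨H.one, hS h1⟩ ∈
        HyperOps.fracSet hH hS₂ (hS h1) Q} = H.colon Q s ∪ H.zeroAt S₂ := by
  have hd' : Disjoint Q S₂ := (Set.disjoint_iff_inter_eq_empty.2 hd).symm
  exact ⟨HyperOps.isWeaklySPrimary_fracSet hH hS₂ (hS h1) hS hd' hprim,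
    HyperOps.exists_contraction_fracSet_eq hH hS₂ (hS h1) hS hd' hprim⟩
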